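/- **Setting.** Let $d\ge 1$ and let $N=(N_1,\dots,N_d)$ be a multivariate point process on $\mathbb R$, defined on a probability space $(\Omega,\mathcal F,P)$; that is, each $N_i$ is a random locally finite counting measure on $\mathbb R$. Assume that $N$ is stationary, i.e. $(N_1(A_1),\dots,N_d(A_d))$ and $(N_1(t+A_1),\dots,N_d(t+A_d))$ have the same law for all Borel sets $A_1,\dots,A_d\subseteq\mathbb R$ and all $t\in\mathbb R$, and simple, i.e. almost surely all jumps have size one and no two components jump simultaneously. For $A\subseteq\{1,\dots,d\}$ let $\mathcal F_A(t)$ be the $\sigma$-algebra generated by the restrictions of $N_a$, $a\in A$, to $(-\infty,t]$, let $\mathcal F_A(t-)=\bigvee_{s<t}\mathcal F_A(s)$, and write $\mathcal F_{-i}=\mathcal F_{\{1,\dots,d\}\setminus\{i\}}$ and $\mathcal F(t)=\mathcal F_{\{1,\dots,d\}}(t)$. Let $N$ be a multivariate Hawkes process: for each $i$ the component $N_i$ has the conditional intensity $$\lambda_i(t)=\nu_i+\sum_{j=1}^d\int_{(0,\infty)}\varphi_{ij}(u)\,dN_j(t-u),\qquad t\in\mathbb R,$$ where $\nu_i>0$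 and the link functions $\varphi_{ij}:\mathbb R\to[0,\infty)$ are measurable with $\varphi_{ij}(u)=0$ for $u\le 0$ and $\int_0^\infty\varphi_{ij}(u)\,du<1$. Being the conditional intensity of $N_i$ means that $\lambda_i$ is predictable with respect to $(\mathcal F(t))_{t\in\mathbb R}$, is almost surely integrable over bounded intervals, and satisfies $E\int X(t)\lambda_i(t)\,dt=E\int X(t)\,dN_i(t)$ for all non-negative predictable processes $X$. For $i,j\in\{1,\dots,d\}$, $N_i$ does not Granger-cause $N_j$ with respect to $N$ if $\lambda_j(t)$ is $\mathcal F_{-i}(t-)$-measurable for all $t\in\mathbb R$; it does not Granger-cause $N_j$ up to null sets if, for all $t\in\mathbb R$, $\lambda_j(t)$ is almost surely equal to an $\mathcal F_{-i}(t-)$-measurable random variable. **Proposition.** Let $i,j\in\{1,\dots,d\}$. 1. If $\varphi_{ji}$ is left-continuous, then $N_i$ does not Granger-cause $N_j$ with respect to $N$ if and only if $\varphi_{ji}(u)=0$ for all $u\in\mathbb R$; the same equivalence holds for Granger non-causality up to null sets. 2. Without the assumption of left-continuity, $N_i$ does not Granger-cause $N_j$ with respect to $N$ up to null sets if and only if $\varphi_{ji}(u)=0$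 for almost every $u\in\mathbb R$. -/

import Mathlib

open MeasureTheory Set
open scoped ENNReal

namespace Hawkes

variable {Ω : Type*} {d : ℕ}

/-- A locally finite counting measure on the real line. -/
structure IsCountingMeasure (m : Measure ℝ) : Prop where
  locallyFinite : IsLocallyFiniteMeasure m
  integerValued : ∀ B : Set ℝ, MeasurableSet B → ∃ n : ℕ∞, m B = (n : ℝ≥0∞)

/-- A `d`-variate point process on the real line: each component is a random counting measure. -/
structure IsPointProcess [MeasurableSpace Ω] (N : Fin d → Ω → Measure ℝ) : Prop where
  measurable : ∀ i, Measurable (N i)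
  counting : ∀ i ω, IsCountingMeasure (N i ω)

/-- Stationarity: the joint law of `N₁(A₁), …, N_d(A_d)` is invariant under translations. -/
def IsStationary [MeasurableSpace Ω] (P : Measure Ω) (N : Fin d → Ω → Measure ℝ) : Prop :=
  ∀ A : Fin d → Set ℝ, (∀ i, MeasurableSet (A i)) → ∀ t : ℝ,
    P.map (fun ω i => N i ω (A i)) = P.map (fun ω i => N i ω ((fun a => t + a) '' A i))

/-- Simplicity: almost surely all jumps have size one and no two components jump
simultaneously. -/
def IsSimple [MeasurableSpace Ω] (P : Measure Ω) (N : Fin d → Ω → Measure ℝ) : Prop :=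
  ∀ᵐ ω ∂P, ∀ t : ℝ, ∑ i, N i ω {t} ≤ 1

/-- The σ-algebra `F_A(t)` generated by the components `N_a`, `a ∈ A`, on `(-∞, t]`. -/
@[reducible]
noncomputable def history (N : Fin d → Ω → Measure ℝ) (A : Set (Fin d)) (t : ℝ) : MeasurableSpace Ω :=
  ⨆ a ∈ A, MeasurableSpace.comap (fun ω => (N a ω).restrict (Iic t)) inferInstance

/-- The σ-algebra `F_A(t-)` generated by all `F_A(s)`, `s < t`. -/
@[reducible]
noncomputable def historyLeft (N : Fin d → Ω → Measure ℝ) (A : Set (Fin d)) (t : ℝ) : MeasurableSpace Ω :=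
  ⨆ s ∈ Iio t, history N A s

/-- The predictable σ-algebra on `ℝ × Ω` of a family of σ-algebras `(F t)` indexed by `ℝ`
(`MeasureTheory.Filtration.predictable` requires a least time). -/
@[reducible]
def predictable (F : ℝ → MeasurableSpace Ω) : MeasurableSpace (ℝ × Ω) :=
  MeasurableSpace.generateFrom {S | ∃ s A, MeasurableSet[F s] A ∧ S = Ioi s ×ˢ A}

/-- `lam` is the conditional intensity of the component `N i` with respect to the canonical
filtration of the whole process `N`. -/
structure IsConditionalIntensity [MeasurableSpace Ω] (P : Measure Ω)
    (N : Fin d → Ω → Measure ℝ) (i : Fin d) (lam : ℝ → Ω → ℝ≥0∞) : Prop where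
  measurable_predictable : Measurable[predictable (history N univ)] (fun p : ℝ × Ω => lam p.1 p.2)
  locallyIntegrable : ∀ᵐ ω ∂P, ∀ a b : ℝ, ∫⁻ t in Icc a b, lam t ω < ∞
  lintegral_eq : ∀ X : ℝ → Ω → ℝ≥0∞,
    Measurable[predictable (history N univ)] (fun p : ℝ × Ω => X p.1 p.2) →
      ∫⁻ ω, (∫⁻ t, X t ω * lam t ω) ∂P = ∫⁻ ω, (∫⁻ t, X t ω ∂(N i ω)) ∂P

/-- `λ_i(t) = ν_i + ∑_j ∫_{u > 0} φ_ij(u) dN_j(t - u)`, the integral being written in the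
variable `s = t - u < t`. -/
noncomputable def intensity (N : Fin d → Ω → Measure ℝ) (ν : Fin d → ℝ)
    (φ : Fin d → Fin d → ℝ → ℝ) (i : Fin d) (t : ℝ) (ω : Ω) : ℝ≥0∞ :=
  ENNReal.ofReal (ν i) + ∑ j, ∫⁻ s in Iio t, ENNReal.ofReal (φ i j (t - s)) ∂(N j ω)

/-- `N` is a multivariate Hawkes process with baseline intensities `ν` and link functions `φ`. -/
structure IsHawkesProcess [MeasurableSpace Ω] (P : Measure Ω) (N : Fin d → Ω → Measure ℝ)
    (ν : Fin d → ℝ) (φ : Fin d → Fin d → ℝ → ℝ) : Prop where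
  pointProcess : IsPointProcess N
  stationary : IsStationary P N
  simple : IsSimple P N
  baseline_pos : ∀ i, 0 < ν i
  link_measurable : ∀ i j, Measurable (φ i j)
  link_nonneg : ∀ i j u, 0 ≤ φ i j u
  link_eq_zero : ∀ i j u, u ≤ 0 → φ i j u = 0
  link_integral_lt_one : ∀ i j, ∫⁻ u in Ioi (0 : ℝ), ENNReal.ofReal (φ i j u) < 1
  conditionalIntensity : ∀ i, IsConditionalIntensity P N i (intensity N ν φ i)

/-- `N_i` does not Granger-cause the component with conditional intensity `lam`, with respect to
`N`: for every `t`, `lam t` is `F_{-i}(t-)`-measurable. -/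
def GrangerNoncausal (N : Fin d → Ω → Measure ℝ) (i : Fin d) (lam : ℝ → Ω → ℝ≥0∞) : Prop :=
  ∀ t : ℝ, Measurable[historyLeft N {i}ᶜ t] (lam t)

/-- The same notion for the `P`-completed σ-algebras: for every `t`, `lam t` is almost surely equal
to an `F_{-i}(t-)`-measurable random variable. -/
def GrangerNoncausalAE [MeasurableSpace Ω] (P : Measure Ω) (N : Fin d → Ω → Measure ℝ)
    (i : Fin d) (lam : ℝ → Ω → ℝ≥0∞) : Prop :=
  ∀ t : ℝ, ∃ g : Ω → ℝ≥0∞, Measurable[historyLeft N {i}ᶜ t] g ∧ lam t =ᵐ[P] g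

end Hawkes

namespace Hawkes

variable {Ω : Type*} {d : ℕ}

/-! If `φ j i` vanishes, `λ_j(t)` involves only the other components before `t`. If it vanishes only
almost everywhere, the term of `N_i` is almost surely zero, because a Lebesgue-null set of times
almost surely carries no jump.

Conversely, fix `t` with `λ_j(t)` almost surely finite, and `a < t`. While the other components are
quiet on `(a, t)`, an `F_{-i}(t-)`-measurable version of `λ_j(t)` equals some `F(a)`-measurable `h`.
While all components are quiet, `λ_j(t)` equals the intensity computed from the past at `a`. Every
`F(a)`-event of positive probability meets the fully quiet event with positive probability
(`measure_eq_zero_of_inter_noJump`), so these two `F(a)`-measurable variables agree almost surely.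
If only `N_i` jumps, its contribution to `λ_j(t)` must therefore vanish. But were `φ j i` nonzero on
a non-null set, with positive probability `N_i` alone would jump at a time where it contributes
(`measure_single_component_jump_ne_zero`).

Left-continuity upgrades vanishing almost everywhere to vanishing everywhere. -/

/-! ### Random measures and atoms of counting measures -/

/-- Restriction to a measurable set is a measurable operation on measures. -/
theorem measurable_measure_restrict {α : Type*} [MeasurableSpace α] {S : Set α}
    (hS : MeasurableSet S) : Measurable fun m : Measure α => m.restrict S := by
  refine Measure.measurable_of_measurable_coe _ fun T hT => ?_
  simp only [Measure.restrict_apply hT]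
  exact Measure.measurable_coe (hT.inter hS)

/-- Joint measurability of a parametric integral against a random locally finite measure. -/
theorem measurable_lintegral_randomMeasure {Ω β : Type*} {mΩ : MeasurableSpace Ω}
    {mβ : MeasurableSpace β} {M : Ω → Measure ℝ} (hM : Measurable M)
    (hfin : ∀ ω, IsLocallyFiniteMeasure (M ω)) {f : β × Ω → ℝ → ℝ≥0∞}
    (hf : Measurable (Function.uncurry f)) :
    Measurable fun p : β × Ω => ∫⁻ u, f p u ∂(M p.2) := by
  have key : ∀ n : ℤ, Measurable fun p : β × Ω => ∫⁻ u in Ioc (n : ℝ) (n + 1), f p u ∂(M p.2) := by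
    intro n
    let I := Ioc (n : ℝ) (n + 1)
    have hI : MeasurableSet I := measurableSet_Ioc
    have hMI : Measurable fun ω => M ω I := (Measure.measurable_coe hI).comp hM
    -- Dividing by the mass of the cell gives a kernel of mass at most one, and the mass is
    -- multiplied back below. On a cell of mass zero this is `∞ • 0 = 0`.
    let κ : ProbabilityTheory.Kernel (β × Ω) ℝ :=
      { toFun := fun p => (M p.2 I)⁻¹ • (M p.2).restrict I
        measurable' := by
          refine Measure.measurable_of_measurable_coe _ fun T hT => ?_
          simp only [Measure.smul_apply, smul_eq_mul, Measure.restrict_apply hT]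
          exact (hMI.inv.mul ((Measure.measurable_coe (hT.inter hI)).comp hM)).comp
            measurable_snd }
    have hκ : ∀ p, κ p = (M p.2 I)⁻¹ • (M p.2).restrict I := fun _ => rfl
    have : ProbabilityTheory.IsFiniteKernel κ := by
      refine ⟨1, ENNReal.one_lt_top, fun p => ?_⟩
      rw [hκ]
      simp [ENNReal.inv_mul_le_one]
    have hmeas := (hMI.comp (measurable_snd (α := β))).mul
      (Measurable.lintegral_kernel_prod_right (κ := κ) hf)
    convert hmeas using 1
    ext p
    have hlt : M p.2 I < ∞ := by
      have := hfin p.2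
      exact measure_Ioc_lt_top
    simp only [Pi.mul_apply, Function.comp_apply, hκ, lintegral_smul_measure, smul_eq_mul]
    rcases eq_or_ne (M p.2 I) 0 with h0 | h0
    · rw [h0, zero_mul, Measure.restrict_eq_zero.2 h0, lintegral_zero_measure]
    · rw [← mul_assoc, ENNReal.mul_inv_cancel h0 hlt.ne, one_mul]
  have heq : (fun p : β × Ω => ∫⁻ u, f p u ∂(M p.2)) =
      fun p => ∑' n : ℤ, ∫⁻ u in Ioc (n : ℝ) (n + 1), f p u ∂(M p.2) := by
    ext p
    rw [← lintegral_iUnion (fun _ => measurableSet_Ioc) (pairwise_disjoint_Ioc_intCast ℝ),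
      iUnion_Ioc_intCast, Measure.restrict_univ]
  rw [heq]
  exact Measurable.tsum key

theorem IsCountingMeasure.one_le {m : Measure ℝ} (hm : IsCountingMeasure m) {B : Set ℝ}
    (hB : MeasurableSet B) (h : m B ≠ 0) : 1 ≤ m B := by
  obtain ⟨n, hn⟩ := hm.integerValued B hB
  rw [hn] at h ⊢
  have : n ≠ 0 := by rintro rfl; simp at h
  exact_mod_cast Order.one_le_iff_ne_zero.2 this

theorem IsCountingMeasure.sum {d : ℕ} {m : Fin d → Measure ℝ}
    (hm : ∀ i, IsCountingMeasure (m i)) : IsCountingMeasure (∑ i, m i) := by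
  refine ⟨⟨fun x => ?_⟩, fun B hB => ?_⟩
  · refine ⟨Icc (x - 1) (x + 1), Icc_mem_nhds (by linarith) (by linarith), ?_⟩
    rw [Measure.finsetSum_apply, ENNReal.sum_lt_top]
    intro i _
    have := (hm i).locallyFinite
    exact measure_Icc_lt_top
  · choose n hn using fun i => (hm i).integerValued B hB
    refine ⟨∑ i, n i, ?_⟩
    rw [Measure.finsetSum_apply, Finset.sum_congr rfl fun i _ => hn i]
    induction (Finset.univ : Finset (Fin d)) using Finset.induction_on with
    | empty => simp
    | insert a s ha ih => rw [Finset.sum_insert ha, Finset.sum_insert ha, ih]; simp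

/-- A counting measure charging a bounded interval has a first atom there. -/
theorem IsCountingMeasure.exists_first_atom {m : Measure ℝ} (hm : IsCountingMeasure m) {a t : ℝ}
    (h : m (Ioc a t) ≠ 0) : ∃ τ ∈ Ioc a t, m {τ} ≠ 0 ∧ m (Ioo a τ) = 0 := by
  have := hm.locallyFinite
  have hat : a < t := by
    by_contra hle
    exact h (by rw [Ioc_eq_empty hle, measure_empty])
  let S : Set ℝ := {s | a < s ∧ m (Ioc a s) ≠ 0}
  have hS : S.Nonempty := ⟨t, hat, h⟩
  have hbdd : BddBelow S := ⟨a, fun s hs => hs.1.le⟩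
  have hτt : sInf S ≤ t := csInf_le hbdd ⟨hat, h⟩
  have haτ : a ≤ sInf S := le_csInf hS fun s hs => hs.1.le
  have hopen : m (Ioo a (sInf S)) = 0 := by
    obtain ⟨u, -, hu, hlim⟩ := exists_seq_strictMono_tendsto (sInf S)
    have hsub : Ioo a (sInf S) ⊆ ⋃ n, Ioc a (u n) := fun x hx => by
      obtain ⟨n, hn⟩ := (hlim.eventually (lt_mem_nhds hx.2)).exists
      exact mem_iUnion.2 ⟨n, hx.1, hn.le⟩
    refine measure_mono_null hsub (measure_iUnion_null fun n => ?_)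
    by_contra hne
    have hn : a < u n := by
      by_contra hle
      exact hne (by rw [Ioc_eq_empty hle, measure_empty])
    exact (hu n).not_ge (csInf_le hbdd ⟨hn, hne⟩)
  -- Integrality enters here: the masses along a sequence decreasing to the infimum are all at least
  -- 1, so their limit cannot vanish.
  have hclosed : m (Ioc a (sInf S)) ≠ 0 := by
    obtain ⟨u, hanti, hu, hlim⟩ := exists_seq_strictAnti_tendsto (sInf S)
    have heq : Ioc a (sInf S) = ⋂ n, Ioc a (u n) := by
      ext x
      simp only [mem_iInter, mem_Ioc]
      refine ⟨fun hx n => ⟨hx.1, hx.2.trans (hu n).le⟩, fun hx => ⟨(hx 0).1, ?_⟩⟩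
      exact ge_of_tendsto' hlim fun n => (hx n).2
    have htend := tendsto_measure_iInter_atTop (μ := m) (s := fun n => Ioc a (u n))
      (fun n => measurableSet_Ioc.nullMeasurableSet)
      (fun i j hij => Ioc_subset_Ioc_right (hanti.antitone hij)) ⟨0, measure_Ioc_lt_top.ne⟩
    rw [← heq] at htend
    have hone : 1 ≤ m (Ioc a (sInf S)) := by
      refine ge_of_tendsto' htend fun n => hm.one_le measurableSet_Ioc ?_
      obtain ⟨s, hs, hsu⟩ := exists_lt_of_csInf_lt hS (hu n)
      exact fun h0 => hs.2 (measure_mono_null (Ioc_subset_Ioc_right hsu.le) h0)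
    exact fun h0 => by simp [h0] at hone
  have hlt : a < sInf S := by
    refine lt_of_le_of_ne haτ fun heq => hclosed ?_
    rw [← heq, Ioc_self, measure_empty]
  refine ⟨sInf S, ⟨hlt, hτt⟩, fun h0 => hclosed ?_, hopen⟩
  rw [← Ioo_union_right hlt]
  exact measure_union_null hopen h0

/-- The atoms of a counting measure do not accumulate from the right. -/
theorem IsCountingMeasure.exists_rat_Ioc_null {m : Measure ℝ} (hm : IsCountingMeasure m) {τ t : ℝ}
    (h : τ < t) : ∃ r : ℚ, τ < r ∧ (r : ℝ) < t ∧ m (Ioc τ r) = 0 := by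
  by_cases h0 : m (Ioc τ t) = 0
  · obtain ⟨r, h1, h2⟩ := exists_rat_btwn h
    exact ⟨r, h1, h2, measure_mono_null (Ioc_subset_Ioc_right h2.le) h0⟩
  · obtain ⟨σ, hσ, -, hσ0⟩ := hm.exists_first_atom h0
    obtain ⟨r, h1, h2⟩ := exists_rat_btwn hσ.1
    exact ⟨r, h1, h2.trans_le hσ.2, measure_mono_null (Ioc_subset_Ioo_right h2) hσ0⟩

/-! ### Histories and predictable sets -/

theorem history_mono (N : Fin d → Ω → Measure ℝ) (A : Set (Fin d)) {s t : ℝ} (hst : s ≤ t) :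
    history N A s ≤ history N A t := by
  refine iSup₂_le fun a ha => le_iSup₂_of_le a ha ?_
  have heq : (fun ω => (N a ω).restrict (Iic s)) =
      (fun m : Measure ℝ => m.restrict (Iic s)) ∘ fun ω => (N a ω).restrict (Iic t) := by
    ext1 ω
    simp only [Function.comp_apply, Measure.restrict_restrict measurableSet_Iic,
      inter_eq_left.2 (Iic_subset_Iic.2 hst)]
  rw [heq, ← MeasurableSpace.comap_comp]
  exact MeasurableSpace.comap_mono (measurable_measure_restrict measurableSet_Iic).comap_le

theorem history_subset (N : Fin d → Ω → Measure ℝ) {A B : Set (Fin d)} (hAB : A ⊆ B) (t : ℝ) :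
    history N A t ≤ history N B t :=
  biSup_mono hAB

theorem history_le [m : MeasurableSpace Ω] {N : Fin d → Ω → Measure ℝ} (hN : IsPointProcess N)
    (A : Set (Fin d)) (t : ℝ) : history N A t ≤ m :=
  iSup₂_le fun a _ => ((measurable_measure_restrict measurableSet_Iic).comp
    (hN.measurable a)).comap_le

theorem measurable_restrict_history (N : Fin d → Ω → Measure ℝ) {A : Set (Fin d)} {k : Fin d}
    (hk : k ∈ A) (t : ℝ) : Measurable[history N A t] fun ω => (N k ω).restrict (Iic t) :=
  Measurable.of_comap_le (le_iSup₂_of_le k hk le_rfl)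

theorem measurable_apply_history (N : Fin d → Ω → Measure ℝ) {A : Set (Fin d)} {k : Fin d}
    (hk : k ∈ A) {t : ℝ} {B : Set ℝ} (hB : MeasurableSet B) (hBt : B ⊆ Iic t) :
    Measurable[history N A t] fun ω => N k ω B := by
  have heq : (fun ω => N k ω B) = (fun m : Measure ℝ => m B) ∘
      fun ω => (N k ω).restrict (Iic t) := by
    ext1 ω
    simp only [Function.comp_apply, Measure.restrict_apply hB, inter_eq_left.2 hBt]
  rw [heq]
  exact (Measure.measurable_coe hB).comp (measurable_restrict_history N hk t)

theorem measurable_restrict_historyLeft (N : Fin d → Ω → Measure ℝ) {A : Set (Fin d)} {k : Fin d}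
    (hk : k ∈ A) (t : ℝ) :
    Measurable[historyLeft N A t] fun ω => (N k ω).restrict (Iio t) := by
  refine @Measure.measurable_of_measurable_coe _ _ _ (historyLeft N A t) _ fun T hT => ?_
  simp only [Measure.restrict_apply hT]
  obtain ⟨u, hmono, hu, hlim⟩ := exists_seq_strictMono_tendsto t
  have heq : ∀ ω, N k ω (T ∩ Iio t) = ⨆ n, N k ω (T ∩ Iic (u n)) := by
    intro ω
    have hU : T ∩ Iio t = ⋃ n, T ∩ Iic (u n) := by
      rw [← inter_iUnion]
      congr 1
      ext x
      simp only [mem_Iio, mem_iUnion, mem_Iic]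
      refine ⟨fun hx => ?_, fun ⟨n, hn⟩ => hn.trans_lt (hu n)⟩
      obtain ⟨n, hn⟩ := (hlim.eventually (lt_mem_nhds hx)).exists
      exact ⟨n, hn.le⟩
    rw [hU, Monotone.measure_iUnion]
    exact fun i j hij => inter_subset_inter_right _ (Iic_subset_Iic.2 (hmono.monotone hij))
  simp only [heq]
  refine Measurable.iSup fun n => ?_
  exact (measurable_apply_history N hk (hT.inter measurableSet_Iic)
    inter_subset_right).mono (le_iSup₂_of_le (u n) (hu n) le_rfl) le_rfl

/-- The event that no component jumps during `(a, t]`. -/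
def noJump (N : Fin d → Ω → Measure ℝ) (a t : ℝ) : Set Ω := {ω | ∀ k, N k ω (Ioc a t) = 0}

theorem measurableSet_noJump (N : Fin d → Ω → Measure ℝ) (a t : ℝ) :
    MeasurableSet[history N univ t] (noJump N a t) := by
  have heq : noJump N a t = ⋂ k, (fun ω => N k ω (Ioc a t)) ⁻¹' {0} := by
    ext ω; simp [noJump]
  rw [heq]
  exact MeasurableSet.iInter fun k => measurable_apply_history N (mem_univ k) measurableSet_Ioc
    Ioc_subset_Iic_self (measurableSet_singleton 0)

theorem noJump_inter_noJump (N : Fin d → Ω → Measure ℝ) {a r t : ℝ} (har : a ≤ r) (hrt : r ≤ t) :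
    noJump N a r ∩ noJump N r t = noJump N a t := by
  ext ω
  simp only [noJump, mem_inter_iff, mem_ofPred_eq, ← Ioc_union_Ioc_eq_Ioc har hrt,
    measure_union_null_iff, forall_and]

theorem predictable_le [m : MeasurableSpace Ω] {F : ℝ → MeasurableSpace Ω} (hF : ∀ t, F t ≤ m) :
    predictable F ≤ (inferInstance : MeasurableSpace (ℝ × Ω)) := by
  refine MeasurableSpace.generateFrom_le ?_
  rintro _ ⟨s, A, hA, rfl⟩
  exact measurableSet_Ioi.prod (hF s _ hA)

theorem measurableSet_predictable_Ioi_prod {F : ℝ → MeasurableSpace Ω} {s : ℝ} {A : Set Ω}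
    (hA : MeasurableSet[F s] A) : MeasurableSet[predictable F] (Ioi s ×ˢ A) :=
  MeasurableSpace.measurableSet_generateFrom ⟨s, A, hA, rfl⟩

theorem measurable_predictable_fst (F : ℝ → MeasurableSpace Ω) :
    Measurable[predictable F] (Prod.fst : ℝ × Ω → ℝ) := by
  refine @measurable_of_Ioi _ _ _ _ _ (predictable F) _ _ _ _ fun s => ?_
  have := measurableSet_predictable_Ioi_prod (F := F) (s := s)
    (@MeasurableSet.univ _ (F s))
  rwa [prod_univ] at this

/-- The times in `U` after `a`, on the event `B`, before which no component has jumped since `a`. -/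
def quietSet (N : Fin d → Ω → Measure ℝ) (a : ℝ) (B : Set Ω) (U : Set ℝ) : Set (ℝ × Ω) :=
  {p | a < p.1 ∧ p.1 ∈ U ∧ p.2 ∈ B ∧ ∀ k, N k p.2 (Ioo a p.1) = 0}

/-- Because `Ioo a s` omits `s`, quietness before `s` is tested on the intervals `Ioc a q` with
rational `q < s`, which leaves countably many generating rectangles. -/
theorem measurableSet_quietSet (N : Fin d → Ω → Measure ℝ) (a : ℝ) {B : Set Ω} {U : Set ℝ}
    (hB : MeasurableSet[history N univ a] B) (hU : MeasurableSet U) :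
    MeasurableSet[predictable (history N univ)] (quietSet N a B U) := by
  have heq : quietSet N a B U = ((Ioi a ×ˢ B) ∩ (Prod.fst ⁻¹' U)) ∩
      (⋃ k, ⋃ q : ℚ, Ioi (q : ℝ) ×ˢ {ω | N k ω (Ioc a q) ≠ 0})ᶜ := by
    ext ⟨s, ω⟩
    simp only [quietSet, mem_ofPred_eq, mem_compl_iff, mem_inter_iff, mem_prod, mem_Ioi, mem_preimage,
      mem_iUnion, not_exists, not_and, not_not]
    constructor
    · rintro ⟨h1, h2, h3, h4⟩
      exact ⟨⟨⟨h1, h3⟩, h2⟩, fun k q hq =>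
        measure_mono_null (Ioc_subset_Ioo_right hq) (h4 k)⟩
    · rintro ⟨⟨⟨h1, h3⟩, h2⟩, h4⟩
      refine ⟨h1, h2, h3, fun k => ?_⟩
      have hsub : Ioo a s ⊆ ⋃ q : {q : ℚ // (q : ℝ) < s}, Ioc a (q : ℝ) := fun x hx => by
        obtain ⟨q, hq1, hq2⟩ := exists_rat_btwn hx.2
        exact mem_iUnion.2 ⟨⟨q, hq2⟩, hx.1, hq1.le⟩
      exact measure_mono_null hsub (measure_iUnion_null fun q => h4 k q q.2)
  rw [heq]
  refine MeasurableSet.inter ((measurableSet_predictable_Ioi_prod hB).inter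
    (measurable_predictable_fst _ hU)) (MeasurableSet.compl ?_)
  refine MeasurableSet.iUnion fun k => MeasurableSet.iUnion fun q =>
    measurableSet_predictable_Ioi_prod ?_
  exact (measurable_apply_history N (mem_univ k) measurableSet_Ioc Ioc_subset_Iic_self
    (measurableSet_singleton 0)).compl

/-! ### The intensity identity and frozen intensities -/

/-- The defining identity of the conditional intensity, for indicators of predictable sets. -/
theorem IsConditionalIntensity.lintegral_set_eq [MeasurableSpace Ω] {P : Measure Ω}
    {N : Fin d → Ω → Measure ℝ} (hN : IsPointProcess N) {i : Fin d} {lam : ℝ → Ω → ℝ≥0∞}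
    (h : IsConditionalIntensity P N i lam) {S : Set (ℝ × Ω)}
    (hS : MeasurableSet[predictable (history N univ)] S) :
    ∫⁻ ω, (∫⁻ t in {t | (t, ω) ∈ S}, lam t ω) ∂P = ∫⁻ ω, N i ω {t | (t, ω) ∈ S} ∂P := by
  have hS' := predictable_le (history_le hN univ) _ hS
  have hsec : ∀ ω, MeasurableSet {t | (t, ω) ∈ S} := fun ω => measurable_prodMk_right hS'
  have hind : Measurable[predictable (history N univ)]
      (S.indicator (fun _ => 1) : ℝ × Ω → ℝ≥0∞) :=
    letI := predictable (history N univ)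
    measurable_const.indicator hS
  have := h.lintegral_eq (fun t ω => S.indicator (fun _ => 1) (t, ω)) hind
  convert this using 2
  · ext1 ω
    rw [← lintegral_indicator (hsec ω)]
    congr 1
    ext t
    by_cases ht : (t, ω) ∈ S <;> simp [indicator, ht]
  · ext1 ω
    rw [← lintegral_indicator_one (hsec ω)]
    rfl

theorem measurable_apply_section [MeasurableSpace Ω] {N : Fin d → Ω → Measure ℝ}
    (hN : IsPointProcess N) (i : Fin d) {S : Set (ℝ × Ω)} (hS : MeasurableSet S) :
    Measurable fun ω => N i ω {t | (t, ω) ∈ S} := by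
  have hsec : ∀ ω, MeasurableSet {t | (t, ω) ∈ S} := fun ω => measurable_prodMk_right hS
  have h := measurable_lintegral_randomMeasure (β := Unit) (hN.measurable i)
    (fun ω => (hN.counting i ω).locallyFinite) (f := fun p t => S.indicator 1 (t, p.2)) (by
      refine (measurable_one.indicator hS).comp (g := S.indicator (1 : ℝ × Ω → ℝ≥0∞))
        (f := fun q : (Unit × Ω) × ℝ => (q.2, q.1.2)) ?_
      fun_prop)
  have h' := h.comp (measurable_prodMk_left (x := ()))
  convert h' using 1
  ext1 ω
  rw [← lintegral_indicator_one (hsec ω)]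
  rfl

/-- The intensity at time `s` computed from the jumps up to time `a` only. -/
noncomputable def pastIntensity (N : Fin d → Ω → Measure ℝ) (ν : Fin d → ℝ)
    (φ : Fin d → Fin d → ℝ → ℝ) (i : Fin d) (a s : ℝ) (ω : Ω) : ℝ≥0∞ :=
  ENNReal.ofReal (ν i) + ∑ j, ∫⁻ u in Iic a, ENNReal.ofReal (φ i j (s - u)) ∂(N j ω)

theorem pastIntensity_le_intensity (N : Fin d → Ω → Measure ℝ) (ν : Fin d → ℝ)
    (φ : Fin d → Fin d → ℝ → ℝ) (i : Fin d) {a s : ℝ} (has : a < s) (ω : Ω) :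
    pastIntensity N ν φ i a s ω ≤ intensity N ν φ i s ω :=
  add_le_add_right (Finset.sum_le_sum fun _ _ =>
    lintegral_mono_set fun _ hx => lt_of_le_of_lt hx has) _

theorem intensity_eq_add (N : Fin d → Ω → Measure ℝ) (ν : Fin d → ℝ)
    (φ : Fin d → Fin d → ℝ → ℝ) (i : Fin d) {a s : ℝ} (has : a < s) (ω : Ω) :
    intensity N ν φ i s ω = pastIntensity N ν φ i a s ω +
      ∑ j, ∫⁻ u in Ioo a s, ENNReal.ofReal (φ i j (s - u)) ∂(N j ω) := by
  have hU : Iio s = Iic a ∪ Ioo a s := (Iic_union_Ioo_eq_Iio has).symm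
  rw [intensity, pastIntensity, add_assoc, ← Finset.sum_add_distrib]
  congr 2
  ext1 j
  rw [hU, lintegral_union measurableSet_Ioo]
  exact disjoint_left.2 fun x hx hx' => hx'.1.not_ge hx

theorem setLIntegral_eq_zero_of_null {m : Measure ℝ} {S : Set ℝ} (h : m S = 0) (f : ℝ → ℝ≥0∞) :
    ∫⁻ u in S, f u ∂m = 0 := by
  rw [Measure.restrict_eq_zero.2 h, lintegral_zero_measure]

theorem intensity_eq_pastIntensity {N : Fin d → Ω → Measure ℝ} (ν : Fin d → ℝ)
    (φ : Fin d → Fin d → ℝ → ℝ) (i : Fin d) {a s : ℝ} (has : a < s) {ω : Ω}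
    (h : ∀ k, N k ω (Ioo a s) = 0) :
    intensity N ν φ i s ω = pastIntensity N ν φ i a s ω := by
  rw [intensity_eq_add N ν φ i has ω,
    Finset.sum_eq_zero fun j _ => setLIntegral_eq_zero_of_null (h j) _, add_zero]

theorem pastIntensity_eq_of_noJump {N : Fin d → Ω → Measure ℝ} (ν : Fin d → ℝ)
    (φ : Fin d → Fin d → ℝ → ℝ) (i : Fin d) {a r : ℝ} (har : a ≤ r) (s : ℝ) {ω : Ω}
    (h : ω ∈ noJump N a r) :
    pastIntensity N ν φ i r s ω = pastIntensity N ν φ i a s ω := by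
  rw [pastIntensity, pastIntensity]
  congr 2
  ext1 j
  rw [← Iic_union_Ioc_eq_Iic har, lintegral_union measurableSet_Ioc,
    setLIntegral_eq_zero_of_null (h j), add_zero]
  exact disjoint_left.2 fun x hx hx' => hx'.1.not_ge hx

theorem measurable_pastIntensity {N : Fin d → Ω → Measure ℝ}
    (hc : ∀ i ω, IsCountingMeasure (N i ω)) (ν : Fin d → ℝ) {φ : Fin d → Fin d → ℝ → ℝ}
    (hφ : ∀ i j, Measurable (φ i j)) (i : Fin d) (a : ℝ) :
    @Measurable _ _ (@Prod.instMeasurableSpace ℝ Ω _ (history N univ a)) _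
      fun p : ℝ × Ω => pastIntensity N ν φ i a p.1 p.2 := by
  let _ := history N univ a
  refine Measurable.const_add (f := fun p : ℝ × Ω =>
    ∑ j, ∫⁻ u in Iic a, ENNReal.ofReal (φ i j (p.1 - u)) ∂(N j p.2)) ?_ _
  refine Finset.measurable_sum _ fun j _ => ?_
  refine measurable_lintegral_randomMeasure (measurable_restrict_history N (mem_univ j) a)
    (fun ω => ?_) (f := fun p u => ENNReal.ofReal (φ i j (p.1 - u))) ?_
  · have := (hc j ω).locallyFinite
    infer_instance
  · have := hφ i j
    unfold Function.uncurry
    fun_prop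

theorem measurable_setLIntegral_pastIntensity {N : Fin d → Ω → Measure ℝ}
    (hc : ∀ i ω, IsCountingMeasure (N i ω)) (ν : Fin d → ℝ) {φ : Fin d → Fin d → ℝ → ℝ}
    (hφ : ∀ i j, Measurable (φ i j)) (i : Fin d) (a : ℝ) (S : Set ℝ) :
    Measurable[history N univ a] fun ω => ∫⁻ s in S, pastIntensity N ν φ i a s ω :=
  let _ := history N univ a
  (measurable_pastIntensity hc ν hφ i a).lintegral_prod_left'

/-! ### Positive conditional probability of no jump -/

/-- If the intensities frozen at time `r` are small over `(r, t]`, the process stays quiet over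
`(r, t]` with positive conditional probability. -/
theorem measure_eq_zero_of_small [MeasurableSpace Ω] {P : Measure Ω} [IsProbabilityMeasure P]
    {N : Fin d → Ω → Measure ℝ} {ν : Fin d → ℝ} {φ : Fin d → Fin d → ℝ → ℝ}
    (hN : IsHawkesProcess P N ν φ) {r t : ℝ} {B : Set Ω}
    (hB : MeasurableSet[history N univ r] B) {ε : ℝ≥0∞} (hε : d * ε < 1)
    (hsmall : ∀ ω ∈ B, ∀ i, ∫⁻ s in Ioc r t, pastIntensity N ν φ i r s ω ≤ ε)
    (hnull : P (B ∩ noJump N r t) = 0) : P B = 0 := by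
  have hB' : MeasurableSet B := history_le hN.pointProcess univ r _ hB
  let S := quietSet N r B (Ioc r t)
  have hS : MeasurableSet[predictable (history N univ)] S :=
    measurableSet_quietSet N r hB measurableSet_Ioc
  have hS' := predictable_le (history_le hN.pointProcess univ) _ hS
  -- On the quiet set the intensity equals the one frozen at `r`, so the expected number of jumps
  -- there is controlled by `ε`.
  have hupper : ∀ i, ∫⁻ ω, N i ω {s | (s, ω) ∈ S} ∂P ≤ ε * P B := by
    intro i
    rw [← (hN.conditionalIntensity i).lintegral_set_eq hN.pointProcess hS, ← setLIntegral_const,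
      ← lintegral_indicator hB']
    refine lintegral_mono fun ω => ?_
    by_cases hω : ω ∈ B
    · rw [indicator_of_mem hω]
      refine le_trans ?_ (hsmall ω hω i)
      have hsub : {s | (s, ω) ∈ S} ⊆ Ioc r t := fun s hs => hs.2.1
      refine le_trans (le_of_eq ?_) (lintegral_mono_set hsub)
      exact setLIntegral_congr_fun (measurable_prodMk_right hS')
        fun s hs => intensity_eq_pastIntensity ν φ i hs.1 hs.2.2.2
    · have hempty : {s | (s, ω) ∈ S} = ∅ := eq_empty_of_forall_notMem fun s hs => hω hs.2.2.1
      simp [hempty]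
  -- Almost every `ω ∈ B` has a jump in `(r, t]`. The first one lies in the quiet set, whose
  -- condition concerns strictly earlier times only.
  have hlower : P B ≤ ∑ i, ∫⁻ ω, N i ω {s | (s, ω) ∈ S} ∂P := by
    rw [← lintegral_finsetSum _ fun i _ => measurable_apply_section hN.pointProcess i hS',
      ← lintegral_indicator_one hB']
    have hae : ∀ᵐ ω ∂P, ω ∉ B ∩ noJump N r t := measure_eq_zero_iff_ae_notMem.1 hnull
    refine lintegral_mono_ae (hae.mono fun ω hω => ?_)
    by_cases hωB : ω ∈ B
    swap
    · simp [hωB]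
    rw [indicator_of_mem hωB]
    have hcount := IsCountingMeasure.sum fun i => hN.pointProcess.counting i ω
    have hjump : (∑ i, N i ω) (Ioc r t) ≠ 0 := by
      intro h0
      rw [Measure.finsetSum_apply, Finset.sum_eq_zero_iff] at h0
      exact hω ⟨hωB, fun k => h0 k (Finset.mem_univ k)⟩
    obtain ⟨τ, hτ, hatom, hquiet⟩ := hcount.exists_first_atom hjump
    have hτS : (τ, ω) ∈ S := by
      refine ⟨hτ.1, hτ, hωB, fun k => ?_⟩
      rw [Measure.finsetSum_apply, Finset.sum_eq_zero_iff] at hquiet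
      exact hquiet k (Finset.mem_univ k)
    calc (1 : ℝ≥0∞) ≤ (∑ i, N i ω) {τ} := hcount.one_le (measurableSet_singleton τ) hatom
      _ = ∑ i, N i ω {τ} := Measure.finsetSum_apply _ _ _
      _ ≤ _ := Finset.sum_le_sum fun i _ => measure_mono (singleton_subset_iff.2 hτS)
  have hle : P B ≤ d * ε * P B := by
    refine hlower.trans ((Finset.sum_le_sum fun i _ => hupper i).trans (le_of_eq ?_))
    simp [mul_assoc]
  by_contra h0
  have hlt : d * ε * P B < 1 * P B :=
    (ENNReal.mul_lt_mul_iff_left h0 (measure_ne_top P B)).2 hε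
  rw [one_mul] at hlt
  exact hlt.not_ge hle

/-- Conditionally on the past at time `a`, the process stays quiet over `(a, t]` with positive
probability. -/
theorem measure_eq_zero_of_inter_noJump [MeasurableSpace Ω] {P : Measure Ω}
    [IsProbabilityMeasure P] {N : Fin d → Ω → Measure ℝ} {ν : Fin d → ℝ}
    {φ : Fin d → Fin d → ℝ → ℝ} (hN : IsHawkesProcess P N ν φ) {a t : ℝ} (hat : a < t)
    {A : Set Ω} (hA : MeasurableSet[history N univ a] A)
    (hnull : P (A ∩ noJump N a t) = 0) : P A = 0 := by
  obtain ⟨ε, hε0, hε⟩ : ∃ ε : ℝ≥0∞, ε ≠ 0 ∧ d * ε < 1 := by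
    refine ⟨((d : ℝ≥0∞) + 1)⁻¹, by simp, ?_⟩
    rw [← div_eq_mul_inv]
    refine ENNReal.div_lt_of_lt_mul' ?_
    rw [mul_one]
    exact ENNReal.lt_add_right (ENNReal.natCast_ne_top d) one_ne_zero
  -- Grid of `n + 1` equal cells from `a` to `t`.
  let r : ℕ → ℕ → ℝ := fun n k => a + k * ((t - a) / (n + 1))
  have hstep : ∀ n : ℕ, 0 < (t - a) / (n + 1) := fun n => div_pos (sub_pos.2 hat) (by positivity)
  have hrmono : ∀ n, Monotone (r n) := fun n k l hkl => by
    have : (k : ℝ) ≤ l := by exact_mod_cast hkl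
    exact add_le_add_right (mul_le_mul_of_nonneg_right this (hstep n).le) a
  have hr0 : ∀ n, r n 0 = a := fun n => by simp [r]
  have hrn : ∀ n, r n (n + 1) = t := fun n => by
    simp only [r]
    push_cast
    field_simp
    ring
  -- Smallness on every cell, expressed through the intensity frozen at `a`, so that the event
  -- belongs to `F(a)`. Cells beyond the grid are cut off at `t`.
  let C : ℕ → Set Ω := fun n => {ω | ∀ k i,
    ∫⁻ s in Ioc (r n k) (r n (k + 1)) ∩ Iic t, pastIntensity N ν φ i a s ω ≤ ε}
  have hC : ∀ n, MeasurableSet[history N univ a] (C n) := by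
    intro n
    have heq : C n = ⋂ k, ⋂ i, (fun ω => ∫⁻ s in Ioc (r n k) (r n (k + 1)) ∩ Iic t,
        pastIntensity N ν φ i a s ω) ⁻¹' Iic ε := by
      ext ω; simp [C]
    rw [heq]
    exact MeasurableSet.iInter fun k => MeasurableSet.iInter fun i =>
      measurable_setLIntegral_pastIntensity hN.pointProcess.counting ν hN.link_measurable i a _
        measurableSet_Iic
  have hCnull : ∀ n, P (A ∩ C n) = 0 := by
    intro n
    have hAC : MeasurableSet[history N univ a] (A ∩ C n) := hA.inter (hC n)
    -- Cells are removed from the right one at a time: without jumps up to `r n k`, freezing there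
    -- or at `a` gives the same intensity.
    have hdown : ∀ k ≤ n + 1, P ((A ∩ C n) ∩ noJump N a (r n k)) = 0 := by
      intro k hk
      induction hk using Nat.decreasingInduction with
      | self =>
        rw [hrn]
        exact measure_mono_null (inter_subset_inter_left _ inter_subset_left) hnull
      | of_succ k hk ih =>
        have hak : a ≤ r n k := by rw [← hr0 n]; exact hrmono n (Nat.zero_le k)
        have hkk : r n k ≤ r n (k + 1) := hrmono n k.le_succ
        have hkt : r n (k + 1) ≤ t := by rw [← hrn n]; exact hrmono n (Nat.succ_le_of_lt hk)
        refine measure_eq_zero_of_small hN (r := r n k) (t := r n (k + 1)) (ε := ε)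
          ((history_mono N univ hak _ hAC).inter (measurableSet_noJump N a _)) hε ?_ ?_
        · rintro ω ⟨⟨-, hωC⟩, hωJ⟩ i
          simp only [pastIntensity_eq_of_noJump ν φ i hak _ hωJ]
          have := hωC k i
          rwa [inter_eq_left.2 (fun x hx => hx.2.trans hkt)] at this
        · rwa [inter_assoc, noJump_inter_noJump N hak hkk]
    have h0 := hdown 0 (Nat.zero_le _)
    rwa [hr0, inter_eq_left.2 (fun ω _ k => by rw [Ioc_self, measure_empty])] at h0
  -- Absolute continuity of the integral: a fine enough mesh makes all cell integrals small, with
  -- `n` depending on `ω`.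
  have hcover : ∀ᵐ ω ∂P, ∃ n, ω ∈ C n := by
    have hfin : ∀ᵐ ω ∂P, ∀ i, ∫⁻ s in Icc a t, intensity N ν φ i s ω < ∞ :=
      ae_all_iff.2 fun i => (hN.conditionalIntensity i).locallyIntegrable.mono fun ω h => h a t
    filter_upwards [hfin] with ω hω
    have hδ : ∀ i, ∃ δ > 0, ∀ S, volume.restrict (Ioc a t) S < δ →
        ∫⁻ s in S, pastIntensity N ν φ i a s ω ∂(volume.restrict (Ioc a t)) < ε := by
      intro i
      refine exists_pos_setLIntegral_lt_of_measure_lt (ne_of_lt ?_) hε0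
      refine lt_of_le_of_lt ?_ (hω i)
      refine le_trans (setLIntegral_mono' measurableSet_Ioc fun s hs =>
        pastIntensity_le_intensity N ν φ i hs.1 ω) (lintegral_mono_set Ioc_subset_Icc_self)
    choose δ hδ0 hδ using hδ
    have hlim : Filter.Tendsto (fun n : ℕ => ENNReal.ofReal ((t - a) / (n + 1)))
        Filter.atTop (nhds 0) := by
      have h1 : Filter.Tendsto (fun n : ℕ => (t - a) / ((n : ℝ) + 1)) Filter.atTop (nhds 0) := by
        have := (tendsto_one_div_add_atTop_nhds_zero_nat (𝕜 := ℝ)).const_mul (t - a)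
        simpa [div_eq_mul_inv] using this
      simpa using ENNReal.tendsto_ofReal h1
    obtain ⟨n, hn⟩ := (Filter.eventually_all.2 fun i =>
      hlim.eventually (gt_mem_nhds (hδ0 i))).exists
    refine ⟨n, fun k i => ?_⟩
    have hak : a ≤ r n k := by rw [← hr0 n]; exact hrmono n (Nat.zero_le k)
    have hsub : Ioc (r n k) (r n (k + 1)) ∩ Iic t ⊆ Ioc a t := fun x hx =>
      ⟨hak.trans_lt hx.1.1, hx.2⟩
    have hlt := hδ i (Ioc (r n k) (r n (k + 1)) ∩ Iic t) (by
      refine lt_of_le_of_lt ((Measure.restrict_apply_le _ _).trans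
        (measure_mono inter_subset_left)) ?_
      rw [Real.volume_Ioc]
      convert hn i using 2
      simp only [r]
      push_cast
      ring)
    rw [Measure.restrict_restrict (measurableSet_Ioc.inter measurableSet_Iic),
      inter_eq_left.2 hsub] at hlt
    exact hlt.le
  have hall : ∀ᵐ ω ∂P, ∀ n, ω ∉ A ∩ C n :=
    ae_all_iff.2 fun n => measure_eq_zero_iff_ae_notMem.1 (hCnull n)
  refine measure_eq_zero_iff_ae_notMem.2 ?_
  filter_upwards [hcover, hall] with ω ⟨n, hn⟩ h hωA
  exact h n ⟨hωA, hn⟩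

/-! ### Jumps of a single component -/

/-- With positive probability the component `i` jumps inside a given non-null set of times while
all other components stay quiet. -/
theorem measure_single_component_jump_ne_zero [MeasurableSpace Ω] {P : Measure Ω}
    [IsProbabilityMeasure P] {N : Fin d → Ω → Measure ℝ} {ν : Fin d → ℝ}
    {φ : Fin d → Fin d → ℝ → ℝ} (hN : IsHawkesProcess P N ν φ) (i : Fin d) {a t : ℝ}
    {U : Set ℝ} (hU : MeasurableSet U) (hUsub : U ⊆ Ioo a t) (hUpos : volume U ≠ 0) :
    P {ω | N i ω U ≠ 0 ∧ ∀ k ∈ ({i}ᶜ : Set (Fin d)), N k ω (Ioo a t) = 0} ≠ 0 := by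
  intro hnull
  have hat : a < t := by
    obtain ⟨x, hx⟩ := nonempty_of_measure_ne_zero hUpos
    exact (hUsub hx).1.trans (hUsub hx).2
  -- If the event had already happened by time `r`, quietness on `(r, t]` would preserve it until
  -- `t`, inside a null event.
  have hDr : ∀ r : ℚ, a < r → (r : ℝ) < t →
      P {ω | N i ω (U ∩ Iic (r : ℝ)) ≠ 0 ∧ ∀ k ∈ ({i}ᶜ : Set (Fin d)), N k ω (Ioc a r) = 0} = 0 := by
    intro r har hrt
    refine measure_eq_zero_of_inter_noJump hN hrt ?_ (measure_mono_null ?_ hnull)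
    · have heq : {ω | N i ω (U ∩ Iic (r : ℝ)) ≠ 0 ∧
          ∀ k ∈ ({i}ᶜ : Set (Fin d)), N k ω (Ioc a r) = 0} =
          ((fun ω => N i ω (U ∩ Iic (r : ℝ))) ⁻¹' {0})ᶜ ∩
            ⋂ k ∈ ({i}ᶜ : Set (Fin d)), (fun ω => N k ω (Ioc a r)) ⁻¹' {0} := by
        ext ω; simp
      rw [heq]
      refine (measurable_apply_history N (mem_univ i) (hU.inter measurableSet_Iic)
        inter_subset_right (measurableSet_singleton 0)).compl.inter ?_
      exact MeasurableSet.biInter (to_countable _) fun k _ => measurable_apply_history N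
        (mem_univ k) measurableSet_Ioc Ioc_subset_Iic_self (measurableSet_singleton 0)
    · rintro ω ⟨⟨h1, h2⟩, h3⟩
      refine ⟨fun h0 => h1 (measure_mono_null inter_subset_left h0), fun k hk => ?_⟩
      refine measure_mono_null (Ioo_subset_Ioc_self.trans ?_) (measure_union_null (h2 k hk) (h3 k))
      rw [Ioc_union_Ioc_eq_Ioc har.le hrt.le]
  let S := quietSet N a univ U
  have hS : MeasurableSet[predictable (history N univ)] S :=
    measurableSet_quietSet N a MeasurableSet.univ hU
  -- A jump of `N_i` in the quiet set is the first jump overall. By simplicity no other component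
  -- jumps with it, and a rational time just after it falls under `hDr`.
  have hjump : ∀ᵐ ω ∂P, N i ω {s | (s, ω) ∈ S} = 0 := by
    have hall : ∀ᵐ ω ∂P, ∀ r : ℚ, a < r → (r : ℝ) < t →
        ω ∉ {ω | N i ω (U ∩ Iic (r : ℝ)) ≠ 0 ∧
          ∀ k ∈ ({i}ᶜ : Set (Fin d)), N k ω (Ioc a r) = 0} := by
      simp only [ae_all_iff]
      exact fun r h1 h2 => measure_eq_zero_iff_ae_notMem.1 (hDr r h1 h2)
    filter_upwards [hall, hN.simple] with ω hω hsimple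
    by_contra hne
    have hcount := IsCountingMeasure.sum fun i => hN.pointProcess.counting i ω
    have hle : ∀ k B, N k ω B ≤ (∑ i, N i ω) B := fun k B => by
      rw [Measure.finsetSum_apply]
      exact Finset.single_le_sum (f := fun i => N i ω B) (fun _ _ => zero_le) (Finset.mem_univ k)
    have hsub : {s | (s, ω) ∈ S} ⊆ U := fun s hs => hs.2.1
    have hjump : (∑ i, N i ω) (Ioc a t) ≠ 0 := fun h0 => hne <|
      measure_mono_null (hsub.trans (hUsub.trans Ioo_subset_Ioc_self))
        (le_antisymm ((hle i _).trans h0.le) (zero_le))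
    obtain ⟨τ, hτ, hatom, hquiet⟩ := hcount.exists_first_atom hjump
    have hquiet' : ∀ k, N k ω (Ioo a τ) = 0 := fun k =>
      le_antisymm ((hle k _).trans hquiet.le) (zero_le)
    have hsub' : {s | (s, ω) ∈ S} ⊆ Ioo a τ ∪ ({s | (s, ω) ∈ S} ∩ {τ}) := by
      intro s hs
      rcases lt_trichotomy s τ with h | h | h
      · exact Or.inl ⟨hs.1, h⟩
      · exact Or.inr ⟨hs, h⟩
      · refine absurd ?_ hatom
        rw [Measure.finsetSum_apply, Finset.sum_eq_zero_iff]
        exact fun k _ => measure_mono_null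
          (singleton_subset_iff.2 (mem_Ioo.2 ⟨hτ.1, h⟩)) (hs.2.2.2 k)
    have hpos : N i ω ({s | (s, ω) ∈ S} ∩ {τ}) ≠ 0 := fun h0 =>
      hne (measure_mono_null hsub' (measure_union_null (hquiet' i) h0))
    have hτU : τ ∈ U := by
      obtain ⟨x, hx, hxτ⟩ := nonempty_of_measure_ne_zero hpos
      rw [← (hxτ : x = τ)]
      exact hsub hx
    have hiτ : N i ω {τ} ≠ 0 := fun h0 => hpos (measure_mono_null inter_subset_right h0)
    have hkτ : ∀ k ∈ ({i}ᶜ : Set (Fin d)), N k ω {τ} = 0 := by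
      intro k hk
      by_contra hkτ
      have h1 := (hN.pointProcess.counting i ω).one_le (measurableSet_singleton τ) hiτ
      have h2 := (hN.pointProcess.counting k ω).one_le (measurableSet_singleton τ) hkτ
      have hsum : N i ω {τ} + N k ω {τ} ≤ 1 := by
        rw [← Finset.sum_pair (f := fun l => N l ω {τ}) (Ne.symm hk)]
        exact (Finset.sum_le_sum_of_subset (Finset.subset_univ _)).trans (hsimple τ)
      have : (1 : ℝ≥0∞) + 1 ≤ 1 := (add_le_add h1 h2).trans hsum
      norm_num at this
    obtain ⟨r, hτr, hrt, hr⟩ := hcount.exists_rat_Ioc_null (hUsub hτU).2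
    refine hω r (hτ.1.trans hτr) hrt ⟨fun h0 => hiτ ?_, fun k hk => ?_⟩
    · exact measure_mono_null (singleton_subset_iff.2 (mem_inter hτU hτr.le)) h0
    · have hcov : Ioc a (r : ℝ) ⊆ (Ioo a τ ∪ {τ}) ∪ Ioc τ r := by
        rw [Ioo_union_right hτ.1, Ioc_union_Ioc_eq_Ioc hτ.1.le hτr.le]
      exact measure_mono_null hcov (measure_union_null (measure_union_null (hquiet' k) (hkτ k hk))
        (le_antisymm ((hle k _).trans hr.le) (zero_le)))
  have hzero : ∫⁻ ω, (∫⁻ s in {s | (s, ω) ∈ S}, intensity N ν φ i s ω) ∂P = 0 := by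
    rw [(hN.conditionalIntensity i).lintegral_set_eq hN.pointProcess hS]
    exact lintegral_eq_zero_of_ae_eq_zero hjump
  have hJmeas : MeasurableSet (noJump N a t) :=
    history_le hN.pointProcess univ t _ (measurableSet_noJump N a t)
  -- On `noJump` the quiet set is all of `U`, where the intensity is at least the positive baseline
  -- `ν i`.
  have hlow : ENNReal.ofReal (ν i) * volume U * P (noJump N a t) ≤
      ∫⁻ ω, (∫⁻ s in {s | (s, ω) ∈ S}, intensity N ν φ i s ω) ∂P := by
    rw [← setLIntegral_const, ← lintegral_indicator hJmeas]
    refine lintegral_mono fun ω => ?_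
    by_cases hω : ω ∈ noJump N a t
    swap
    · simp [hω]
    rw [indicator_of_mem hω]
    have hsec : {s | (s, ω) ∈ S} = U := by
      refine Subset.antisymm (fun s hs => hs.2.1) fun s hs => ?_
      exact ⟨(hUsub hs).1, hs, mem_univ _, fun k =>
        measure_mono_null 
          ((Ioo_subset_Ioo_right (hUsub hs).2.le).trans Ioo_subset_Ioc_self) (hω k)⟩
    rw [hsec, ← setLIntegral_const]
    exact lintegral_mono fun s => le_self_add
  rw [hzero, nonpos_iff_eq_zero, mul_eq_zero, mul_eq_zero, ENNReal.ofReal_eq_zero] at hlow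
  have hP : P (noJump N a t) = 0 :=
    hlow.resolve_left fun h => h.elim (fun h => (hN.baseline_pos i).not_ge h) hUpos
  have := measure_eq_zero_of_inter_noJump hN hat (A := univ) MeasurableSet.univ
    (by rwa [univ_inter])
  simp at this

/-! ### Non-causality forces the link function to vanish -/

/-- As long as the components in `A` do not jump during `(a, t)`, the information in `F_A(t-)` is
already contained in `F_A(a)`. -/
theorem exists_measurable_history_eq (N : Fin d → Ω → Measure ℝ) (A : Set (Fin d)) (a t : ℝ)
    {g : Ω → ℝ≥0∞} (hg : Measurable[historyLeft N A t] g) :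
    ∃ h : Ω → ℝ≥0∞, Measurable[history N A a] h ∧
      ∀ ω, (∀ k ∈ A, N k ω (Ioo a t) = 0) → g ω = h ω := by
  let D : Set Ω := {ω | ∀ k ∈ A, N k ω (Ioo a t) = 0}
  let v : D → Ω := Subtype.val
  -- The quiet event need not lie in `F_A(a)`, so the σ-algebras are compared through their traces
  -- on it, and `h` is then extended to `Ω`.
  have hle : (historyLeft N A t).comap v ≤ (history N A a).comap v := by
    rw [MeasurableSpace.comap_le_iff_le_map]
    refine iSup₂_le fun s hs => iSup₂_le fun k hk => ?_
    rw [← MeasurableSpace.comap_le_iff_le_map]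
    rw [MeasurableSpace.comap_comp]
    have heq : (fun ω => (N k ω).restrict (Iic s)) ∘ v =
        (fun m : Measure ℝ => m.restrict (Iic s)) ∘
          (fun ω => (N k ω).restrict (Iic a)) ∘ v := by
      ext1 ω
      simp only [Function.comp_apply, Measure.restrict_restrict measurableSet_Iic]
      refine Measure.restrict_congr_set (Filter.EventuallyEq.symm ?_)
      refine (inter_subset_left.eventuallyLE).antisymm (ae_le_set.2 ?_)
      refine measure_mono_null ?_ (ω.2 k hk)
      rintro x ⟨hx, hx'⟩
      exact ⟨not_le.1 fun h => hx' ⟨hx, h⟩, lt_of_le_of_lt hx hs⟩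
    rw [heq, ← MeasurableSpace.comap_comp, ← MeasurableSpace.comap_comp]
    refine (MeasurableSpace.comap_mono (MeasurableSpace.comap_mono
      (measurable_measure_restrict measurableSet_Iic).comap_le)).trans ?_
    exact MeasurableSpace.comap_mono (measurable_restrict_history N hk a).comap_le
  have hgv : Measurable[(history N A a).comap v] (g ∘ v) :=
    (hg.comp (comap_measurable v)).mono hle le_rfl
  obtain ⟨h, hh, heq⟩ := Measurable.exists_eq_measurable_comp (mY := history N A a) hgv
  exact ⟨h, hh, fun ω hω => congrFun heq ⟨ω, hω⟩⟩

/-- Local integrability and Fubini provide such a time. Finiteness is what later permits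
cancellation in `ℝ≥0∞`. -/
theorem exists_ae_intensity_lt_top [MeasurableSpace Ω] {P : Measure Ω}
    [IsProbabilityMeasure P] {N : Fin d → Ω → Measure ℝ} {ν : Fin d → ℝ}
    {φ : Fin d → Fin d → ℝ → ℝ} (hN : IsHawkesProcess P N ν φ) (j : Fin d) :
    ∃ t, ∀ᵐ ω ∂P, intensity N ν φ j t ω < ∞ := by
  have hmeas : Measurable fun p : ℝ × Ω => intensity N ν φ j p.1 p.2 :=
    (hN.conditionalIntensity j).measurable_predictable.mono
      (predictable_le (history_le hN.pointProcess univ)) le_rfl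
  have h1 : ∀ᵐ ω ∂P, ∀ᵐ t ∂(volume.restrict (Icc (0 : ℝ) 1)), intensity N ν φ j t ω < ∞ :=
    (hN.conditionalIntensity j).locallyIntegrable.mono fun ω h =>
      ae_lt_top (hmeas.comp measurable_prodMk_right) (h 0 1).ne
  have h2 := (Measure.ae_ae_comm (p := fun ω t => intensity N ν φ j t ω < ∞)
    ((hmeas.comp measurable_swap) measurableSet_Iio)).1 h1
  have : (ae (volume.restrict (Icc (0 : ℝ) 1))).NeBot := by
    rw [ae_neBot, Ne, Measure.restrict_eq_zero, Real.volume_Icc]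
    simp
  exact h2.exists

/-- The same `h` describes `λ_j(t)` whether or not `N_i` jumps while the others are quiet, so an
isolated jump of `N_i` contributes nothing. -/
theorem ae_eq_zero_of_grangerNoncausalAE [MeasurableSpace Ω] {P : Measure Ω}
    [IsProbabilityMeasure P] {N : Fin d → Ω → Measure ℝ} {ν : Fin d → ℝ}
    {φ : Fin d → Fin d → ℝ → ℝ} (hN : IsHawkesProcess P N ν φ) {i j : Fin d}
    (hG : GrangerNoncausalAE P N i (intensity N ν φ j)) : ∀ᵐ u : ℝ, φ j i u = 0 := by
  obtain ⟨t, ht⟩ := exists_ae_intensity_lt_top hN j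
  obtain ⟨g, hg, hlg⟩ := hG t
  have key : ∀ n : ℕ, volume ({u | φ j i u ≠ 0} ∩ Ioo 0 ((n : ℝ) + 1)) = 0 := by
    intro n
    by_contra hpos
    have hat : t - ((n : ℝ) + 1) < t := by linarith [(n.cast_nonneg : (0 : ℝ) ≤ n)]
    generalize ha : t - ((n : ℝ) + 1) = a at hat
    obtain ⟨h, hh, hgh⟩ := exists_measurable_history_eq N {i}ᶜ a t hg
    have hpast : Measurable[history N univ a] (pastIntensity N ν φ j a t) :=
      (measurable_pastIntensity hN.pointProcess.counting ν hN.link_measurable j a).comp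
        (@measurable_prodMk_left _ _ _ (history N univ a) t)
    have hh' : Measurable[history N univ a] h := hh.mono (history_subset N (subset_univ _) a) le_rfl
    -- Equality holds almost surely on `noJump`. Both sides are `F(a)`-measurable, so it holds
    -- almost surely everywhere.
    have hne : P {ω | pastIntensity N ν φ j a t ω ≠ h ω} = 0 := by
      refine measure_eq_zero_of_inter_noJump hN hat
        (MeasurableSet.compl (measurableSet_eq_fun hpast hh'))
        (measure_mono_null ?_ hlg)
      rintro ω ⟨h1, h2⟩ h3
      have h0 : ∀ k, N k ω (Ioo a t) = 0 := fun k => measure_mono_null Ioo_subset_Ioc_self (h2 k)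
      exact h1 (by rw [← intensity_eq_pastIntensity ν φ j hat h0, ← hgh ω fun k _ => h0 k]; exact h3)
    have hφ := hN.link_measurable j i
    have hmp : MeasurePreserving (fun s : ℝ => t - s) := Measure.measurePreserving_sub_left volume t
    have hVmeas : MeasurableSet ({u | φ j i u ≠ 0} ∩ Ioo 0 ((n : ℝ) + 1)) :=
      (hφ (measurableSet_singleton 0)).compl.inter measurableSet_Ioo
    let U := (fun s : ℝ => t - s) ⁻¹' ({u | φ j i u ≠ 0} ∩ Ioo 0 ((n : ℝ) + 1))
    have hUsub : U ⊆ Ioo a t := by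
      rintro s ⟨-, h1, h2⟩
      constructor <;> linarith
    have hUpos : volume U ≠ 0 := by
      rwa [hmp.measure_preimage hVmeas.nullMeasurableSet]
    refine measure_single_component_jump_ne_zero hN i (hmp.measurable hVmeas) hUsub hUpos ?_
    refine measure_eq_zero_iff_ae_notMem.2 ?_
    filter_upwards [measure_eq_zero_iff_ae_notMem.1 hne, ht, hlg] with ω h1 h2 h3 ⟨h4, h5⟩
    have h1' : pastIntensity N ν φ j a t ω = h ω := not_not.1 h1
    have hsum : pastIntensity N ν φ j a t ω +
        ∑ k, ∫⁻ u in Ioo a t, ENNReal.ofReal (φ j k (t - u)) ∂(N k ω) =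
        pastIntensity N ν φ j a t ω + 0 := by
      rw [← intensity_eq_add N ν φ j hat ω, h3, hgh ω h5, h1', add_zero]
    have hfin : pastIntensity N ν φ j a t ω ≠ ∞ :=
      ((pastIntensity_le_intensity N ν φ j hat ω).trans_lt h2).ne
    rw [ENNReal.add_right_inj hfin, Finset.sum_eq_zero_iff] at hsum
    have hi := hsum i (Finset.mem_univ i)
    rw [lintegral_eq_zero_iff (by fun_prop), Filter.EventuallyEq,
      ae_restrict_iff' measurableSet_Ioo] at hi
    refine h4 (measure_mono_null ?_ hi)
    intro s hs hcontra
    have := hcontra (hUsub hs)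
    simp only [Pi.zero_apply, ENNReal.ofReal_eq_zero] at this
    exact hs.1 (le_antisymm this (hN.link_nonneg j i _))
  have hcov : {u | φ j i u ≠ 0} ⊆ ⋃ n : ℕ, {u | φ j i u ≠ 0} ∩ Ioo 0 ((n : ℝ) + 1) := by
    intro u hu
    have hu0 : 0 < u := not_le.1 fun h => hu (hN.link_eq_zero j i u h)
    obtain ⟨n, hn⟩ := exists_nat_gt u
    exact mem_iUnion.2 ⟨n, hu, hu0, by linarith⟩
  exact measure_mono_null hcov (measure_iUnion_null key)

/-! ### Vanishing link functions give non-causality -/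

/-- The intensity without the contribution of component `i`. -/
noncomputable def reducedIntensity (N : Fin d → Ω → Measure ℝ) (ν : Fin d → ℝ)
    (φ : Fin d → Fin d → ℝ → ℝ) (i j : Fin d) (t : ℝ) (ω : Ω) : ℝ≥0∞ :=
  ENNReal.ofReal (ν j) +
    ∑ k ∈ Finset.univ.erase i, ∫⁻ s in Iio t, ENNReal.ofReal (φ j k (t - s)) ∂(N k ω)

theorem intensity_eq_reducedIntensity_add (N : Fin d → Ω → Measure ℝ) (ν : Fin d → ℝ)
    (φ : Fin d → Fin d → ℝ → ℝ) (i j : Fin d) (t : ℝ) (ω : Ω) :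
    intensity N ν φ j t ω = reducedIntensity N ν φ i j t ω +
      ∫⁻ s in Iio t, ENNReal.ofReal (φ j i (t - s)) ∂(N i ω) := by
  rw [intensity, reducedIntensity, add_assoc, Finset.sum_erase_add _ _ (Finset.mem_univ i)]

theorem measurable_reducedIntensity (N : Fin d → Ω → Measure ℝ) (ν : Fin d → ℝ)
    {φ : Fin d → Fin d → ℝ → ℝ} (hφ : ∀ i j, Measurable (φ i j)) (i j : Fin d) (t : ℝ) :
    Measurable[historyLeft N {i}ᶜ t] (reducedIntensity N ν φ i j t) := by
  let _ := historyLeft N {i}ᶜ t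
  refine Measurable.const_add (f := fun ω => ∑ k ∈ Finset.univ.erase i,
    ∫⁻ s in Iio t, ENNReal.ofReal (φ j k (t - s)) ∂(N k ω)) ?_ _
  refine Finset.measurable_sum _ fun k hk => ?_
  have := hφ j k
  exact (Measure.measurable_lintegral
    (f := fun s => ENNReal.ofReal (φ j k (t - s))) (by fun_prop)).comp
    (measurable_restrict_historyLeft N (A := {i}ᶜ) (Finset.ne_of_mem_erase hk) t)

theorem grangerNoncausal_of_eq_zero (N : Fin d → Ω → Measure ℝ) (ν : Fin d → ℝ)
    {φ : Fin d → Fin d → ℝ → ℝ} (hφ : ∀ i j, Measurable (φ i j)) {i j : Fin d}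
    (h : ∀ u, φ j i u = 0) : GrangerNoncausal N i (intensity N ν φ j) := by
  intro t
  have heq : intensity N ν φ j t = reducedIntensity N ν φ i j t := by
    ext ω
    simp [intensity_eq_reducedIntensity_add N ν φ i j t ω, h]
  rw [heq]
  exact measurable_reducedIntensity N ν hφ i j t

theorem GrangerNoncausal.ae [MeasurableSpace Ω] (P : Measure Ω) {N : Fin d → Ω → Measure ℝ}
    {i : Fin d} {lam : ℝ → Ω → ℝ≥0∞} (h : GrangerNoncausal N i lam) :
    GrangerNoncausalAE P N i lam :=
  fun t => ⟨lam t, h t, Filter.EventuallyEq.rfl⟩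

/-- Lebesgue-null sets of times almost surely carry no jump. -/
theorem ae_apply_eq_zero_of_null [MeasurableSpace Ω] {P : Measure Ω}
    {N : Fin d → Ω → Measure ℝ} {ν : Fin d → ℝ} {φ : Fin d → Fin d → ℝ → ℝ}
    (hN : IsHawkesProcess P N ν φ) (i : Fin d) {B : Set ℝ} (hB : MeasurableSet B)
    (h0 : volume B = 0) : ∀ᵐ ω ∂P, N i ω B = 0 := by
  have h := (hN.conditionalIntensity i).lintegral_set_eq hN.pointProcess
    (measurable_predictable_fst (history N univ) hB)
  have hmeas : Measurable fun ω => N i ω B :=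
    (Measure.measurable_coe hB).comp (hN.pointProcess.measurable i)
  have hz : ∫⁻ ω, N i ω B ∂P = 0 := by
    refine h.symm.trans ?_
    have : ∀ ω, ∫⁻ t in B, intensity N ν φ i t ω = 0 := fun ω => setLIntegral_eq_zero_of_null h0 _
    exact (lintegral_congr this).trans lintegral_zero
  exact (lintegral_eq_zero_iff hmeas).1 hz

/-- For fixed `t`, the times `s` with `φ j i (t - s) ≠ 0` form a Lebesgue-null set, which almost
surely carries no jump of `N_i`. -/
theorem grangerNoncausalAE_of_ae_eq_zero [MeasurableSpace Ω] {P : Measure Ω}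
    {N : Fin d → Ω → Measure ℝ} {ν : Fin d → ℝ} {φ : Fin d → Fin d → ℝ → ℝ}
    (hN : IsHawkesProcess P N ν φ) {i j : Fin d} (h : ∀ᵐ u : ℝ, φ j i u = 0) :
    GrangerNoncausalAE P N i (intensity N ν φ j) := by
  intro t
  refine ⟨_, measurable_reducedIntensity N ν hN.link_measurable i j t, ?_⟩
  have hmp : MeasurePreserving (fun s : ℝ => t - s) := Measure.measurePreserving_sub_left volume t
  have hB : MeasurableSet {u | φ j i u ≠ 0} :=
    (hN.link_measurable j i (measurableSet_singleton 0)).compl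
  have hnull : volume ((fun s : ℝ => t - s) ⁻¹' {u | φ j i u ≠ 0}) = 0 := by
    rw [hmp.measure_preimage hB.nullMeasurableSet]
    exact h
  filter_upwards [ae_apply_eq_zero_of_null hN i (hmp.measurable hB) hnull] with ω hω
  rw [intensity_eq_reducedIntensity_add N ν φ i j t ω]
  convert add_zero _
  refine lintegral_eq_zero_of_ae_eq_zero (ae_restrict_of_ae ?_)
  filter_upwards [measure_eq_zero_iff_ae_notMem.1 hω] with s hs
  have h0 : φ j i (t - s) = 0 := not_not.1 hs
  simp [h0]

/-- A nonzero value would persist on some `Ioc l u`, which has positive length. -/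
theorem eq_zero_of_ae_eq_zero_of_leftContinuous {f : ℝ → ℝ}
    (hf : ∀ u, ContinuousWithinAt f (Iic u) u) (h : ∀ᵐ u, f u = 0) (u : ℝ) : f u = 0 := by
  by_contra hne
  obtain ⟨l, hl, hsub⟩ := (mem_nhdsLE_iff_exists_Ioc_subset).1 ((hf u).eventually_ne hne)
  have h0 : volume (Ioc l u) = 0 := measure_mono_null hsub h
  rw [Real.volume_Ioc, ENNReal.ofReal_eq_zero] at h0
  have : l < u := hl
  linarith

end Hawkes

theorem mainTheorem1 {Ω : Type*} [MeasurableSpace Ω] (P : Measure Ω) [IsProbabilityMeasure P]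
    {d : ℕ} (N : Fin d → Ω → Measure ℝ) (ν : Fin d → ℝ) (φ : Fin d → Fin d → ℝ → ℝ)
    (hN : Hawkes.IsHawkesProcess P N ν φ) (i j : Fin d) :
    ((∀ u : ℝ, ContinuousWithinAt (φ j i) (Iic u) u) →
      (Hawkes.GrangerNoncausal N i (Hawkes.intensity N ν φ j) ↔ ∀ u : ℝ, φ j i u = 0) ∧
      (Hawkes.GrangerNoncausalAE P N i (Hawkes.intensity N ν φ j) ↔ ∀ u : ℝ, φ j i u = 0)) ∧
    (Hawkes.GrangerNoncausalAE P N i (Hawkes.intensity N ν φ j) ↔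
      ∀ᵐ u : ℝ, φ j i u = 0) := by
  refine ⟨fun hcont => ?_, Hawkes.ae_eq_zero_of_grangerNoncausalAE hN,
    Hawkes.grangerNoncausalAE_of_ae_eq_zero hN⟩
  have hzero : Hawkes.GrangerNoncausalAE P N i (Hawkes.intensity N ν φ j) →
      ∀ u : ℝ, φ j i u = 0 := fun h =>
    Hawkes.eq_zero_of_ae_eq_zero_of_leftContinuous hcont
      (Hawkes.ae_eq_zero_of_grangerNoncausalAE hN h)
  have hgranger := Hawkes.grangerNoncausal_of_eq_zero N ν hN.link_measurable (i := i) (j := j)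
  exact ⟨⟨fun h => hzero (h.ae P), hgranger⟩, ⟨hzero, fun h => (hgranger h).ae P⟩⟩
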